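/- Let $k,n$ be nonnegative integers with $k\le n/2$. Write $I_{k,n-k}=\operatorname{diag}(I_k,-I_{n-k})$ and $$\mathrm{Gr}(k,n)=\{Q\in\mathbb R^{n\times n}: Q^{\mathsf T}Q=I,\ Q^{\mathsf T}=Q,\ \operatorname{tr}(Q)=2k-n\},$$ regarded as a Riemannian submanifold of $\mathbb R^{n\times n}$ with the metric $\langle X,Y\rangle=\operatorname{tr}(X^{\mathsf T}Y)$; thus a geodesic of $\mathrm{Gr}(k,n)$ is a smooth curve $\gamma$ in $\mathrm{Gr}(k,n)$ such that $\ddot\gamma(t)$ is orthogonal to the tangent space of $\mathrm{Gr}(k,n)$ at $\gamma(t)$ for every $t$. Let $Q_0,Q_1\in\mathrm{Gr}(k,n)$ with $Q_0=V_0I_{k,n-k}V_0^{\mathsf T}$ and $Q_1=V_1I_{k,n-k}V_1^{\mathsf T}$, where $V_0,V_1\in\mathrm O(n)$, and let a CS decomposition of $V_0^{\mathsf T}V_1$ be $$V_0^{\mathsf T}V_1=\begin{bmatrix}U&0\\0&V\end{bmatrix}\begin{bmatrix}\cos\Theta&\sin\Theta&0\\-\sin\Theta&\cos\Theta&0\\0&0&I_{n-2k}\end{bmatrix}\begin{bmatrix}W&0\\0&Z\end{bmatrix}^{\mathsf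 T},$$ where $U,W\in\mathrm O(k)$, $V,Z\in\mathrm O(n-k)$ and $\Theta=\operatorname{diag}(\theta_1,\dots,\theta_k)\in\mathbb R^{k\times k}$. Put $B=-2U[\Theta,0]V^{\mathsf T}\in\mathbb R^{k\times(n-k)}$ with $0\in\mathbb R^{k\times(n-2k)}$, and $$\gamma(t)=V_0\exp\left(\frac t2\begin{bmatrix}0&-B\\B^{\mathsf T}&0\end{bmatrix}\right)I_{k,n-k}\exp\left(\frac t2\begin{bmatrix}0&B\\-B^{\mathsf T}&0\end{bmatrix}\right)V_0^{\mathsf T},\qquad t\in\mathbb R.$$ Then $\gamma$ is a geodesic of $\mathrm{Gr}(k,n)$ with $\gamma(0)=Q_0$, $\gamma(1)=Q_1$ and $\dot\gamma(0)=V_0\begin{bmatrix}0&B\\B^{\mathsf T}&0\end{bmatrix}V_0^{\mathsf T}$. If moreover the angles are normalized as usual, $\theta_i\in[0,\pi/2]$ for all $i$, then $\gamma$ restricted to $[0,1]$ has minimal length $\int_0^1\|\dot c(t)\|_{\mathsf F}\,dt$ among all $C^1$ curves $c:[0,1]\to\mathrm{Gr}(k,n)$ from $Q_0$ to $Q_1$.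 -/

import Mathlib

open scoped Matrix ContDiff Matrix.Norms.Frobenius

/-- The splitting of `n` coordinates into the first `k` and the last `n - k`. -/
def splitEquiv {k n : ℕ} (hk : k ≤ n) : Fin k ⊕ Fin (n - k) ≃ Fin n :=
  finSumFinEquiv.trans (finCongr (Nat.add_sub_of_le hk))

/-- The `n × n` matrix with blocks `[A, B; C, D]`, where `A` is `k × k` and `D` is
`(n - k) × (n - k)`. -/
def blockMatrix {k n : ℕ} (hk : k ≤ n)
    (A : Matrix (Fin k) (Fin k) ℝ) (B : Matrix (Fin k) (Fin (n - k)) ℝ)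
    (C : Matrix (Fin (n - k)) (Fin k) ℝ) (D : Matrix (Fin (n - k)) (Fin (n - k)) ℝ) :
    Matrix (Fin n) (Fin n) ℝ :=
  Matrix.reindex (splitEquiv hk) (splitEquiv hk) (Matrix.fromBlocks A B C D)

/-- The matrix `I_{k,n-k} = diag(I_k, -I_{n-k})`. -/
def signatureMatrix {k n : ℕ} (hk : k ≤ n) : Matrix (Fin n) (Fin n) ℝ :=
  blockMatrix hk 1 0 0 (-1)

/-- The Grassmannian `Gr(k,n)` in the involution model: the symmetric orthogonal real
`n × n` matrices of trace `2k - n`. -/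
def Grassmannian (k n : ℕ) : Set (Matrix (Fin n) (Fin n) ℝ) :=
  {Q | Q ∈ Matrix.orthogonalGroup (Fin n) ℝ ∧ Qᵀ = Q ∧ Q.trace = 2 * (k : ℝ) - (n : ℝ)}

/-- The tangent space of `Gr(k,n)` at `Q`: the velocities at time `0` of the smooth curves
`c : (-ε, ε) → Gr(k,n)` with `c 0 = Q`. -/
def grassmannianTangent (k n : ℕ) (Q : Matrix (Fin n) (Fin n) ℝ) :
    Set (Matrix (Fin n) (Fin n) ℝ) :=
  {X | ∃ (ε : ℝ) (c : ℝ → Matrix (Fin n) (Fin n) ℝ), 0 < ε ∧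
    ContDiffOn ℝ ∞ c (Set.Ioo (-ε) ε) ∧ (∀ t ∈ Set.Ioo (-ε) ε, c t ∈ Grassmannian k n) ∧
    c 0 = Q ∧ HasDerivAt c X 0}

/-- Geodesics of `Gr(k,n)` with the Riemannian metric `⟨X, Y⟩ = tr(Xᵀ Y)` induced from the
Euclidean space of all `n × n` matrices: the smooth curves in `Gr(k,n)` whose covariant
acceleration, i.e. the orthogonal projection of `γ''(t)` to the tangent space at `γ(t)`,
vanishes. In other words, `γ''(t)` is orthogonal to every tangent vector at `γ(t)`. -/
structure IsGrassmannGeodesic (k n : ℕ) (γ : ℝ → Matrix (Fin n) (Fin n) ℝ) : Prop where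
  smooth : ContDiff ℝ ∞ γ
  mem : ∀ t, γ t ∈ Grassmannian k n
  normal_acceleration : ∀ t, ∀ X ∈ grassmannianTangent k n (γ t),
    ((deriv (deriv γ) t)ᵀ * X).trace = 0

/-- The length of a `C¹` curve of matrices over `[0,1]`; the norm is the Frobenius norm, which
is the norm of the Riemannian metric `⟨X, Y⟩ = tr(Xᵀ Y)`. -/
noncomputable def curveLength {n : ℕ} (c : ℝ → Matrix (Fin n) (Fin n) ℝ) : ℝ :=
  ∫ t in (0 : ℝ)..1, ‖derivWithin c (Set.Icc 0 1) t‖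

/-- The restriction of `γ` to `[0,1]` has minimal length among all `C¹` curves `[0,1] → Gr(k,n)`
with the same endpoints. -/
def IsLengthMinimizing (k n : ℕ) (γ : ℝ → Matrix (Fin n) (Fin n) ℝ) : Prop :=
  ∀ c : ℝ → Matrix (Fin n) (Fin n) ℝ, ContDiffOn ℝ 1 c (Set.Icc 0 1) →
    (∀ t ∈ Set.Icc (0 : ℝ) 1, c t ∈ Grassmannian k n) → c 0 = γ 0 → c 1 = γ 1 →
    curveLength γ ≤ curveLength c

/-- The curve
`t ↦ V₀ exp(t/2 [0, -B; Bᵀ, 0]) I_{k,n-k} exp(t/2 [0, B; -Bᵀ, 0]) V₀ᵀ`. -/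
noncomputable def expCurve {k n : ℕ} (hk : k ≤ n) (V₀ : Matrix (Fin n) (Fin n) ℝ)
    (B : Matrix (Fin k) (Fin (n - k)) ℝ) (t : ℝ) : Matrix (Fin n) (Fin n) ℝ :=
  V₀ * NormedSpace.exp ((t / 2) • blockMatrix hk 0 (-B) Bᵀ 0) * signatureMatrix hk *
    NormedSpace.exp ((t / 2) • blockMatrix hk 0 B (-Bᵀ) 0) * V₀ᵀ

theorem le_of_two_mul_le {k n : ℕ} (h : 2 * k ≤ n) : k ≤ n := by omega

/-- The splitting of `n - k` coordinates into the first `k` and the last `n - 2k`. -/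
def splitEquivTail {k n : ℕ} (h : 2 * k ≤ n) : Fin k ⊕ Fin (n - 2 * k) ≃ Fin (n - k) :=
  finSumFinEquiv.trans (finCongr (by omega))

/-- The `k × (n - k)` matrix `[M, 0]`, where `M` is `k × k` and `0` is `k × (n - 2k)`. -/
def padRight {k n : ℕ} (h : 2 * k ≤ n) (M : Matrix (Fin k) (Fin k) ℝ) :
    Matrix (Fin k) (Fin (n - k)) ℝ :=
  Matrix.reindex (Equiv.refl (Fin k)) (splitEquivTail h) (Matrix.fromCols M 0)

/-- The `(n - k) × k` matrix `[M; 0]`, where `M` is `k × k` and `0` is `(n - 2k) × k`. -/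
def padBelow {k n : ℕ} (h : 2 * k ≤ n) (M : Matrix (Fin k) (Fin k) ℝ) :
    Matrix (Fin (n - k)) (Fin k) ℝ :=
  Matrix.reindex (splitEquivTail h) (Equiv.refl (Fin k)) (Matrix.fromRows M 0)

/-- The `n × n` matrix `[cos Θ, sin Θ, 0; -sin Θ, cos Θ, 0; 0, 0, I_{n-2k}]` with
`Θ = diag(θ₁, …, θ_k)`. -/
noncomputable def csMatrix {k n : ℕ} (h : 2 * k ≤ n) (θ : Fin k → ℝ) :
    Matrix (Fin n) (Fin n) ℝ :=
  blockMatrix (le_of_two_mul_le h)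
    (Matrix.diagonal fun i => Real.cos (θ i))
    (padRight h (Matrix.diagonal fun i => Real.sin (θ i)))
    (padBelow h (-Matrix.diagonal fun i => Real.sin (θ i)))
    (Matrix.reindex (splitEquivTail h) (splitEquivTail h)
      (Matrix.fromBlocks (Matrix.diagonal fun i => Real.cos (θ i)) 0 0 1))

/-! Let `J` be the signature matrix and `A = [0, -B; Bᵀ, 0]`. Since `J` anticommutes with `A`, the
two half-exponentials merge and `γ(t) = V₀ exp(tA) J V₀ᵀ`. Hence `γ'' = Sγ` with `S = V₀ A² V₀ᵀ`
constant, symmetric and commuting with `γ`. Tangent vectors at `Q` anticommute with `Q`, by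
differentiating `Q² = 1`, and are therefore orthogonal to everything commuting with `Q`, in
particular to `γ''`. This is `isGrassmannGeodesic_mul_exp_smul`.

For the endpoint, `exp(A/2)` is the CS rotation conjugated by `diag(U, V)` (`exp_half_off_diag_eq`),
and the block diagonal factors disappear because they commute with `J`.

Minimality is a calibration argument. In the frame `O = V₀ diag(U, V)`, consider `f(Q) = ∑ θᵢ arccos
(OᵀQO)ᵢᵢ` over the first `k` indices. By `sum_mul_diag_sq_le`, `f` is Lipschitz along curves with
constant `‖θ‖/√2`, and it grows from `0` to `∑ θᵢ · 2θᵢ = 2‖θ‖²` between the endpoints; here `θᵢ ∈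
[0, π/2]` gives `arccos (cos 2θᵢ) = 2θᵢ`. So every competitor has length at least `2√2 ‖θ‖`, which
is the length `‖A‖ = √2 ‖B‖` of `γ`. -/

theorem HasDerivAt.matrix_apply {m p : Type*} [Fintype m] [Fintype p] {c : ℝ → Matrix m p ℝ}
    {D : Matrix m p ℝ} {t : ℝ} (hc : HasDerivAt c D t) (i : m) (j : p) :
    HasDerivAt (fun s => c s i j) (D i j) t :=
  hasDerivAt_pi.1 (hasDerivAt_pi.1 hc i) j

/-! ### Frobenius norm: trace form, Cauchy–Schwarz, orthogonal invariance. -/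

section Frobenius

variable {m p : Type*} [Fintype m] [Fintype p]

theorem frobenius_norm_sq (A : Matrix m p ℝ) : ‖A‖ ^ 2 = ∑ i, ∑ j, A i j ^ 2 := by
  rw [Matrix.frobenius_norm_def, ← Real.sqrt_eq_rpow, Real.sq_sqrt]
  · simp
  · positivity

theorem frobenius_norm_sq_eq_trace (A : Matrix m p ℝ) : ‖A‖ ^ 2 = (Aᵀ * A).trace := by
  rw [frobenius_norm_sq, Finset.sum_comm]
  simp [Matrix.trace, Matrix.mul_apply, sq]

theorem trace_transpose_mul_sq_le (A D : Matrix m p ℝ) :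
    (Aᵀ * D).trace ^ 2 ≤ ‖A‖ ^ 2 * ‖D‖ ^ 2 := by
  have e : (Aᵀ * D).trace = ∑ x : m × p, A x.1 x.2 * D x.1 x.2 := by
    rw [Fintype.sum_prod_type, Finset.sum_comm]
    simp [Matrix.trace, Matrix.mul_apply]
  rw [e, frobenius_norm_sq, frobenius_norm_sq, ← Fintype.sum_prod_type',
    ← Fintype.sum_prod_type']
  exact Finset.sum_mul_sq_le_sq_mul_sq _ _ _

variable [DecidableEq m]

theorem frobenius_norm_orthogonal_mul {O : Matrix m m ℝ} (hO : Oᵀ * O = 1) (A : Matrix m p ℝ) :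
    ‖O * A‖ = ‖A‖ := by
  have : ‖O * A‖ ^ 2 = ‖A‖ ^ 2 := by
    rw [frobenius_norm_sq_eq_trace, frobenius_norm_sq_eq_trace, Matrix.transpose_mul,
      Matrix.mul_assoc, ← Matrix.mul_assoc Oᵀ, hO, Matrix.one_mul]
  exact (sq_eq_sq₀ (norm_nonneg _) (norm_nonneg _)).1 this

theorem frobenius_norm_mul_orthogonal {O : Matrix m m ℝ} (hO : O * Oᵀ = 1) (A : Matrix p m ℝ) :
    ‖A * O‖ = ‖A‖ := by
  have : ‖A * O‖ ^ 2 = ‖A‖ ^ 2 := by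
    rw [frobenius_norm_sq_eq_trace, frobenius_norm_sq_eq_trace, Matrix.transpose_mul,
      Matrix.mul_assoc, Matrix.trace_mul_comm, Matrix.mul_assoc, Matrix.mul_assoc, hO,
      Matrix.mul_one]
  exact (sq_eq_sq₀ (norm_nonneg _) (norm_nonneg _)).1 this

end Frobenius

/-! ### The calibrating function and its Lipschitz bound. -/

section Calibration

variable {m : Type*} [Fintype m] [DecidableEq m]

/-- A bound for nonnegative combinations of the diagonal entries of a tangent vector `D` at the
symmetric involution `Q`. The matrices `eᵢ eᵢᵀ - Q eᵢ eᵢᵀ Q` have pairwise nonpositive inner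
products, so that only the diagonal terms contribute. -/
theorem sum_mul_diag_sq_le {Q D : Matrix m m ℝ} (hQ : Q * Q = 1) (hQs : Qᵀ = Q)
    (hD : Q * D + D * Q = 0) {b : m → ℝ} (hb : ∀ i, 0 ≤ b i) :
    (∑ i, b i * D i i) ^ 2 ≤ 1 / 2 * ‖D‖ ^ 2 * ∑ i, b i ^ 2 * (1 - Q i i ^ 2) := by
  set L : Matrix m m ℝ := Matrix.diagonal b with hL
  -- `N / 2` is the component of `L` anticommuting with `Q`. As `D` anticommutes with `Q`, pairing
  -- with `N` loses nothing, and Cauchy–Schwarz is sharper for `N` than for `L`.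
  set N : Matrix m m ℝ := L - Q * L * Q with hN
  have hLs : Lᵀ = L := by simp [hL]
  have hNs : Nᵀ = N := by
    simp [hN, Matrix.transpose_mul, hQs, hLs, Matrix.mul_assoc]
  have hQDQ : Q * D * Q = -D := by
    have h1 : Q * D = -(D * Q) := eq_neg_of_add_eq_zero_left hD
    rw [h1, Matrix.neg_mul, Matrix.mul_assoc, hQ, Matrix.mul_one]
  have htr : ∑ i, b i * D i i = (L * D).trace := by
    simp [hL, Matrix.trace, Matrix.diagonal_mul]
  have hcyc : (Q * L * Q * D).trace = -(L * D).trace := by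
    rw [Matrix.mul_assoc, Matrix.mul_assoc, Matrix.trace_mul_comm, Matrix.mul_assoc,
      hQDQ]
    simp
  have hND : (Nᵀ * D).trace = 2 * (L * D).trace := by
    rw [hNs, hN, Matrix.sub_mul, Matrix.trace_sub, hcyc]; ring
  have hLL : (L * L).trace = ∑ i, b i ^ 2 := by
    simp [hL, Matrix.trace, sq]
  have hLQLQ : (L * (Q * L * Q)).trace = ∑ i, ∑ j, b i * b j * Q i j ^ 2 := by
    have hsymm : ∀ i j, Q i j = Q j i := fun i j => congrFun₂ hQs j i
    simp only [Matrix.trace, Matrix.diag, hL, Matrix.diagonal_mul]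
    refine Finset.sum_congr rfl fun i _ => ?_
    rw [Matrix.mul_apply, Finset.mul_sum]
    refine Finset.sum_congr rfl fun j _ => ?_
    rw [Matrix.mul_diagonal, hsymm j i]; ring
  have hNN : ‖N‖ ^ 2 = 2 * ∑ i, b i ^ 2 - 2 * ∑ i, ∑ j, b i * b j * Q i j ^ 2 := by
    rw [frobenius_norm_sq_eq_trace, hNs, ← hLL, ← hLQLQ]
    have e1 : N * N = L * L - L * (Q * L * Q) - Q * L * Q * L + Q * L * (Q * Q) * L * Q := by
      rw [hN]; noncomm_ring
    have e2 : (Q * L * Q * L).trace = (L * (Q * L * Q)).trace := by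
      rw [Matrix.trace_mul_comm]
    have e3 : (Q * L * (Q * Q) * L * Q).trace = (L * L).trace := by
      rw [hQ, Matrix.mul_one, Matrix.trace_mul_comm, Matrix.mul_assoc, ← Matrix.mul_assoc, hQ,
        Matrix.one_mul]
    rw [e1, Matrix.trace_add, Matrix.trace_sub, Matrix.trace_sub, e2, e3]; ring
  -- The discarded off-diagonal terms `bᵢ bⱼ Qᵢⱼ²` are nonnegative; this is where the sign of `b`
  -- enters.
  have hdiag : ∑ i, b i ^ 2 * Q i i ^ 2 ≤ ∑ i, ∑ j, b i * b j * Q i j ^ 2 := by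
    refine Finset.sum_le_sum fun i _ => ?_
    have := Finset.single_le_sum (f := fun j => b i * b j * Q i j ^ 2)
      (fun j _ => mul_nonneg (mul_nonneg (hb i) (hb j)) (sq_nonneg _)) (Finset.mem_univ i)
    simpa [sq] using this
  have hN' : ‖N‖ ^ 2 ≤ 2 * ∑ i, b i ^ 2 * (1 - Q i i ^ 2) := by
    rw [hNN]
    simp only [mul_sub, mul_one, Finset.sum_sub_distrib]
    linarith
  have hCS := trace_transpose_mul_sq_le N D
  rw [hND] at hCS
  rw [htr]
  have := mul_le_mul_of_nonneg_right hN' (sq_nonneg ‖D‖)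
  nlinarith

theorem diag_sq_le_one {Q : Matrix m m ℝ} (hQ : Q * Q = 1) (hQs : Qᵀ = Q) (i : m) :
    Q i i ^ 2 ≤ 1 := by
  have h1 : ∑ j, Q i j * Q j i = 1 := by
    rw [← Matrix.mul_apply, hQ, Matrix.one_apply_eq]
  have h2 := Finset.single_le_sum (f := fun j => Q i j * Q j i)
      (fun j _ => by
        have : Q j i = Q i j := congrFun₂ hQs i j
        rw [this]; exact mul_self_nonneg _) (Finset.mem_univ i)
  simp only [h1] at h2
  nlinarith

/-- The left side is the derivative of `∑ wᵢ arccos (r Qᵢᵢ)` in the direction `D`. The singular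
factor of `arccos'` is absorbed by the weight `1 - Qᵢᵢ²` in `sum_mul_diag_sq_le`, which makes the
bound uniform in `r`. -/
theorem sum_mul_arccos_deriv_le {Q D : Matrix m m ℝ} (hQ : Q * Q = 1) (hQs : Qᵀ = Q)
    (hD : Q * D + D * Q = 0) {w : m → ℝ} (hw : ∀ i, 0 ≤ w i) {r : ℝ} (hr0 : 0 < r) (hr1 : r < 1) :
    ∑ i, w i * (-(1 / √(1 - (r * Q i i) ^ 2)) * (r * D i i)) ≤
      √(1 / 2 * ∑ i, w i ^ 2) * ‖D‖ := by
  have hq := diag_sq_le_one hQ hQs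
  have hpos : ∀ i, 0 < 1 - (r * Q i i) ^ 2 := fun i => by
    have := hq i
    nlinarith [mul_le_mul_of_nonneg_left this (sq_nonneg r)]
  set b : m → ℝ := fun i => w i * r / √(1 - (r * Q i i) ^ 2) with hb
  have hb0 : ∀ i, 0 ≤ b i := fun i => by
    have := hw i
    positivity
  have h1 := sum_mul_diag_sq_le hQ hQs hD hb0
  have h2 : ∑ i, b i ^ 2 * (1 - Q i i ^ 2) ≤ ∑ i, w i ^ 2 := by
    refine Finset.sum_le_sum fun i _ => ?_
    have hp := hpos i
    have hbi : b i = w i * r / √(1 - (r * Q i i) ^ 2) := rfl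
    rw [hbi, div_pow, Real.sq_sqrt hp.le, mul_pow, div_mul_eq_mul_div, div_le_iff₀ hp, mul_assoc]
    refine mul_le_mul_of_nonneg_left ?_ (sq_nonneg _)
    -- With `q = Qᵢᵢ`, this is `r²(1 - q²) ≤ 1 - r²q²`, true because `r² ≤ 1`.
    nlinarith
  have h3 : ∑ i, w i * (-(1 / √(1 - (r * Q i i) ^ 2)) * (r * D i i)) = -∑ i, b i * D i i := by
    rw [← Finset.sum_neg_distrib]
    refine Finset.sum_congr rfl fun i _ => ?_
    rw [hb]; ring
  rw [h3]
  refine le_trans (neg_le_abs _) (abs_le_of_sq_le_sq ?_ (by positivity))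
  rw [mul_pow, Real.sq_sqrt (by positivity)]
  nlinarith [mul_le_mul_of_nonneg_left h2 (sq_nonneg ‖D‖)]

theorem anticommute_of_hasDerivAt_involution {c : ℝ → Matrix m m ℝ} {D : Matrix m m ℝ} {t : ℝ}
    (hc : HasDerivAt c D t) (hinv : ∀ᶠ s in nhds t, c s * c s = 1) : c t * D + D * c t = 0 := by
  have h1 : HasDerivAt (fun s => c s * c s) (D * c t + c t * D) t := hc.mul hc
  have h2 : HasDerivAt (fun s => c s * c s) 0 t :=
    (hasDerivAt_const t (1 : Matrix m m ℝ)).congr_of_eventuallyEq hinv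
  rw [add_comm]
  exact h1.unique h2

/-- The factor `r < 1` keeps the argument of `arccos` off `±1`, where it is not differentiable.
These values do occur: in the application the curve starts at the signature matrix. -/
theorem sum_mul_arccos_sub_le_of_lt_one {c : ℝ → Matrix m m ℝ}
    (hc : ContDiffOn ℝ 1 c (Set.Icc 0 1)) (hinv : ∀ t ∈ Set.Icc (0 : ℝ) 1, c t * c t = 1)
    (hsymm : ∀ t ∈ Set.Icc (0 : ℝ) 1, (c t)ᵀ = c t) {w : m → ℝ} (hw : ∀ i, 0 ≤ w i) {r : ℝ}
    (hr0 : 0 < r) (hr1 : r < 1) :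
    ∑ i, w i * Real.arccos (r * c 1 i i) - ∑ i, w i * Real.arccos (r * c 0 i i) ≤
      √(1 / 2 * ∑ i, w i ^ 2) * ∫ t in (0 : ℝ)..1, ‖derivWithin c (Set.Icc 0 1) t‖ := by
  have hcont : ContinuousOn c (Set.Icc 0 1) := hc.continuousOn
  have hentry : ∀ i, ContinuousOn (fun t => c t i i) (Set.Icc 0 1) := fun i =>
    (continuous_id.matrix_elem i i).comp_continuousOn hcont
  have hderivcont : ContinuousOn (derivWithin c (Set.Icc 0 1)) (Set.Icc 0 1) :=
    hc.continuousOn_derivWithin (uniqueDiffOn_Icc zero_lt_one) le_rfl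
  have hd : ∀ t ∈ Set.Ioo (0 : ℝ) 1, HasDerivAt c (derivWithin c (Set.Icc 0 1) t) t := by
    intro t ht
    exact ((hc.differentiableOn one_ne_zero t (Set.Ioo_subset_Icc_self ht)).hasDerivWithinAt).hasDerivAt
      (Icc_mem_nhds ht.1 ht.2)
  rw [← intervalIntegral.integral_const_mul]
  refine intervalIntegral.sub_le_integral_of_hasDeriv_right_of_le
    (g := fun t => ∑ i, w i * Real.arccos (r * c t i i))
    (g' := fun t => ∑ i, w i * (-(1 / √(1 - (r * c t i i) ^ 2)) *
      (r * derivWithin c (Set.Icc 0 1) t i i))) zero_le_one ?_ ?_ ?_ ?_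
  · refine continuousOn_finsetSum _ fun i _ => ?_
    exact continuousOn_const.mul
      (Real.continuous_arccos.comp_continuousOn (continuousOn_const.mul (hentry i)))
  · intro t ht
    have hti := Set.Ioo_subset_Icc_self ht
    refine HasDerivAt.hasDerivWithinAt (HasDerivAt.fun_sum fun i _ => ?_)
    have hlt : |r * c t i i| < 1 := by
      have h1 := diag_sq_le_one (hinv t hti) (hsymm t hti) i
      rw [abs_mul, abs_of_pos hr0]
      have h2 : |c t i i| ≤ 1 := abs_le_one_iff_mul_self_le_one.2 (by rwa [← sq])
      nlinarith [abs_nonneg (c t i i)]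
    rw [abs_lt] at hlt
    exact ((Real.hasDerivAt_arccos hlt.1.ne' hlt.2.ne).comp t
      (((hd t ht).matrix_apply i i).const_mul r)).const_mul (w i)
  · exact (continuousOn_const.mul hderivcont.norm).integrableOn_Icc
  · intro t ht
    have hti := Set.Ioo_subset_Icc_self ht
    refine sum_mul_arccos_deriv_le (hinv t hti) (hsymm t hti) ?_ hw hr0 hr1
    refine anticommute_of_hasDerivAt_involution (hd t ht) ?_
    filter_upwards [Icc_mem_nhds ht.1 ht.2] with s hs using hinv s hs

/-- The function `Q ↦ ∑ᵢ wᵢ arccos Qᵢᵢ` on the symmetric involutions is Lipschitz with constant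
`‖w‖ / √2` along `C¹` curves. -/
theorem sum_mul_arccos_sub_le {c : ℝ → Matrix m m ℝ}
    (hc : ContDiffOn ℝ 1 c (Set.Icc 0 1)) (hinv : ∀ t ∈ Set.Icc (0 : ℝ) 1, c t * c t = 1)
    (hsymm : ∀ t ∈ Set.Icc (0 : ℝ) 1, (c t)ᵀ = c t) {w : m → ℝ} (hw : ∀ i, 0 ≤ w i) :
    ∑ i, w i * Real.arccos (c 1 i i) - ∑ i, w i * Real.arccos (c 0 i i) ≤
      √(1 / 2 * ∑ i, w i ^ 2) * ∫ t in (0 : ℝ)..1, ‖derivWithin c (Set.Icc 0 1) t‖ := by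
  have hcont : Continuous fun r : ℝ =>
      ∑ i, w i * Real.arccos (r * c 1 i i) - ∑ i, w i * Real.arccos (r * c 0 i i) := by
    refine Continuous.sub ?_ ?_ <;>
    · refine continuous_finsetSum _ fun i _ => continuous_const.mul ?_
      exact Real.continuous_arccos.comp (continuous_id.mul continuous_const)
  -- The right side does not involve `r` and `arccos` is continuous up to `±1`, so `r` may tend to
  -- `1` from the left.
  have hlim := (hcont.tendsto 1).mono_left (nhdsWithin_le_nhds (s := Set.Iio 1))
  simp only [one_mul] at hlim
  refine le_of_tendsto hlim ?_
  filter_upwards [Ioo_mem_nhdsLT (zero_lt_one' ℝ)] with r hr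
  exact sum_mul_arccos_sub_le_of_lt_one hc hinv hsymm hw hr.1 hr.2

end Calibration

/-! ### One-parameter groups and anticommutation with an involution. -/

section Flow

variable {m : Type*} [Fintype m] [DecidableEq m]

theorem exp_smul_transpose_of_skew {A : Matrix m m ℝ} (hA : Aᵀ = -A) (t : ℝ) :
    (NormedSpace.exp (t • A))ᵀ = NormedSpace.exp (t • -A) := by
  rw [← Matrix.exp_transpose, Matrix.transpose_smul, hA]

theorem exp_smul_mul_exp_smul_neg (A : Matrix m m ℝ) (t : ℝ) :
    NormedSpace.exp (t • A) * NormedSpace.exp (t • -A) = 1 := by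
  rw [← Matrix.exp_add_of_commute _ _
    (((Commute.refl A).neg_right.smul_left t).smul_right t)]
  simp

theorem mul_exp_smul_neg_of_anticommute {A J : Matrix m m ℝ} (hJ : J * J = 1)
    (hAJ : J * A = -(A * J)) (t : ℝ) :
    J * NormedSpace.exp (t • -A) = NormedSpace.exp (t • A) * J := by
  let u : (Matrix m m ℝ)ˣ := ⟨J, J, hJ, hJ⟩
  have h1 := Matrix.exp_units_conj u (t • -A)
  have h2 : (u : Matrix m m ℝ) * (t • -A) * ((u⁻¹ : (Matrix m m ℝ)ˣ) : Matrix m m ℝ) =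
      t • A := by
    change J * (t • -A) * J = t • A
    rw [Matrix.mul_smul, Matrix.mul_neg, hAJ, neg_neg, Matrix.smul_mul, Matrix.mul_assoc, hJ,
      Matrix.mul_one]
  rw [h2] at h1
  change _ = J * NormedSpace.exp (t • -A) * J at h1
  rw [h1, Matrix.mul_assoc, hJ, Matrix.mul_one]

/-- Moving `J` across an exponential reverses the sign of the exponent, so the two halves add up. A
single exponential is easier to differentiate. -/
theorem exp_half_conj_involution {A J : Matrix m m ℝ} (hJ : J * J = 1)
    (hAJ : J * A = -(A * J)) (t : ℝ) :
    NormedSpace.exp ((t / 2) • A) * J * NormedSpace.exp ((t / 2) • -A) =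
      NormedSpace.exp (t • A) * J := by
  rw [Matrix.mul_assoc, mul_exp_smul_neg_of_anticommute hJ hAJ, ← Matrix.mul_assoc,
    ← Matrix.exp_add_of_commute _ _ (Commute.refl _), ← add_smul, add_halves]

theorem hasDerivAt_mul_exp_smul_mul (V A M : Matrix m m ℝ) (t : ℝ) :
    HasDerivAt (fun s : ℝ => V * NormedSpace.exp (s • A) * M)
      (V * NormedSpace.exp (t • A) * (A * M)) t := by
  have h := ((hasDerivAt_exp_smul_const (𝕂 := ℝ) A t).const_mul V).mul_const M
  have e : V * (NormedSpace.exp (t • A) * A) * M = V * NormedSpace.exp (t • A) * (A * M) := by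
    simp only [Matrix.mul_assoc]
  rw [← e]
  exact h

theorem contDiff_mul_exp_smul_mul (V A M : Matrix m m ℝ) :
    ContDiff ℝ ∞ (fun s : ℝ => V * NormedSpace.exp (s • A) * M) := by
  have h : ContDiff ℝ ∞ (NormedSpace.exp : Matrix m m ℝ → Matrix m m ℝ) :=
    contDiff_iff_contDiffAt.2 fun x => (NormedSpace.exp_analytic (𝕂 := ℝ) x).contDiffAt
  exact (contDiff_const.mul (h.comp (contDiff_id.smul contDiff_const))).mul contDiff_const

/-- A matrix `G` that commutes with the involution `Q` is orthogonal to every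
matrix that anticommutes with `Q`. -/
theorem trace_mul_eq_zero_of_anticommute {Q G X : Matrix m m ℝ} (hQ : Q * Q = 1)
    (hG : Q * G = G * Q) (hX : Q * X + X * Q = 0) : (G * X).trace = 0 := by
  have h1 : Q * X = -(X * Q) := eq_neg_of_add_eq_zero_left hX
  have h2 : (G * X).trace = -(G * X).trace := by
    calc (G * X).trace = (Q * (Q * G * X)).trace := by
          rw [← Matrix.mul_assoc, ← Matrix.mul_assoc, hQ, Matrix.one_mul]
      _ = (Q * G * X * Q).trace := Matrix.trace_mul_comm _ _
      _ = (G * (Q * X) * Q).trace := by rw [hG]; simp only [Matrix.mul_assoc]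
      _ = -(G * X * (Q * Q)).trace := by
          rw [h1, Matrix.mul_neg, Matrix.neg_mul, Matrix.trace_neg]
          simp only [Matrix.mul_assoc]
      _ = -(G * X).trace := by rw [hQ, Matrix.mul_one]
  linarith

end Flow

/-! ### Geodesics and curve lengths in the Grassmannian. -/

theorem transpose_mem_orthogonalGroup {n : ℕ} {O : Matrix (Fin n) (Fin n) ℝ}
    (hO : O ∈ Matrix.orthogonalGroup (Fin n) ℝ) : Oᵀ ∈ Matrix.orthogonalGroup (Fin n) ℝ :=
  (Matrix.mem_orthogonalGroup_iff _ _).2 <| by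
    rw [Matrix.transpose_transpose]; exact (Matrix.mem_orthogonalGroup_iff' _ _).1 hO

theorem mul_self_of_mem_grassmannian {k n : ℕ} {Q : Matrix (Fin n) (Fin n) ℝ}
    (hQ : Q ∈ Grassmannian k n) : Q * Q = 1 := by
  have h := (Matrix.mem_orthogonalGroup_iff _ _).1 hQ.1
  rwa [hQ.2.1] at h

/-- Only this inclusion of the tangent space is needed: orthogonality to all anticommuting matrices
is more than the geodesic equation asks. -/
theorem anticommute_of_mem_grassmannianTangent {k n : ℕ} {Q X : Matrix (Fin n) (Fin n) ℝ}
    (hX : X ∈ grassmannianTangent k n Q) : Q * X + X * Q = 0 := by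
  obtain ⟨ε, c, hε, -, hmem, rfl, hd⟩ := hX
  refine anticommute_of_hasDerivAt_involution hd ?_
  filter_upwards [Ioo_mem_nhds (neg_lt_zero.2 hε) hε] with s hs
  exact mul_self_of_mem_grassmannian (hmem s hs)

theorem conj_orthogonal_mem_grassmannian {k n : ℕ} {O Q : Matrix (Fin n) (Fin n) ℝ}
    (hO : O ∈ Matrix.orthogonalGroup (Fin n) ℝ) (hQ : Q ∈ Grassmannian k n) :
    O * Q * Oᵀ ∈ Grassmannian k n := by
  have hO' : Oᵀ ∈ Matrix.orthogonalGroup (Fin n) ℝ := transpose_mem_orthogonalGroup hO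
  refine ⟨mul_mem (mul_mem hO hQ.1) hO', ?_, ?_⟩
  · rw [Matrix.transpose_mul, Matrix.transpose_mul, Matrix.transpose_transpose, hQ.2.1,
      Matrix.mul_assoc]
  · have h : Oᵀ * O = 1 := (Matrix.mem_orthogonalGroup_iff' _ _).1 hO
    rw [Matrix.trace_mul_comm, ← Matrix.mul_assoc, h, Matrix.one_mul, hQ.2.2]

theorem exp_smul_mem_orthogonalGroup {n : ℕ} {A : Matrix (Fin n) (Fin n) ℝ} (hA : Aᵀ = -A)
    (t : ℝ) : NormedSpace.exp (t • A) ∈ Matrix.orthogonalGroup (Fin n) ℝ := by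
  rw [Matrix.mem_orthogonalGroup_iff, exp_smul_transpose_of_skew hA,
    exp_smul_mul_exp_smul_neg]

theorem isGrassmannGeodesic_mul_exp_smul {k n : ℕ} {V A J : Matrix (Fin n) (Fin n) ℝ}
    (hV : V ∈ Matrix.orthogonalGroup (Fin n) ℝ) (hJ : J ∈ Grassmannian k n) (hA : Aᵀ = -A)
    (hAJ : J * A = -(A * J)) :
    IsGrassmannGeodesic k n fun t => V * NormedSpace.exp (t • A) * (J * Vᵀ) := by
  have hJJ := mul_self_of_mem_grassmannian hJ
  have hVV : Vᵀ * V = 1 := (Matrix.mem_orthogonalGroup_iff' _ _).1 hV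
  have hmem : ∀ t : ℝ, V * NormedSpace.exp (t • A) * (J * Vᵀ) ∈ Grassmannian k n := fun t => by
    have h := conj_orthogonal_mem_grassmannian hV
      (conj_orthogonal_mem_grassmannian (exp_smul_mem_orthogonalGroup hA (t / 2)) hJ)
    rw [exp_smul_transpose_of_skew hA, exp_half_conj_involution hJJ hAJ] at h
    simpa only [Matrix.mul_assoc] using h
  refine ⟨contDiff_mul_exp_smul_mul _ _ _, hmem, fun t X hX => ?_⟩
  have hd1 : deriv (fun t : ℝ => V * NormedSpace.exp (t • A) * (J * Vᵀ)) =
      fun t : ℝ => V * NormedSpace.exp (t • A) * (A * (J * Vᵀ)) :=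
    funext fun s => (hasDerivAt_mul_exp_smul_mul _ _ _ s).deriv
  have hd2 : deriv (fun t : ℝ => V * NormedSpace.exp (t • A) * (A * (J * Vᵀ))) t =
      V * NormedSpace.exp (t • A) * (A * (A * (J * Vᵀ))) :=
    (hasDerivAt_mul_exp_smul_mul V A (A * (J * Vᵀ)) t).deriv
  rw [hd1, hd2]
  have hX' := anticommute_of_mem_grassmannianTangent hX
  have hm := hmem t
  have hQQ := mul_self_of_mem_grassmannian hm
  set E := NormedSpace.exp (t • A) with hE
  have hcomm : A * E = E * A :=
    (((Commute.refl A).smul_right t).exp_right).eq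
  set Q := V * E * (J * Vᵀ) with hQ
  -- The acceleration is `S * Q`. `S` commutes with `Q` because `A²` commutes with both `J` and
  -- `exp(tA)`.
  set S := V * (A * A) * Vᵀ with hS
  have hAAJ : A * A * J = J * (A * A) := by
    rw [← Matrix.mul_assoc, hAJ, Matrix.neg_mul, Matrix.mul_assoc A J A, hAJ]
    simp [Matrix.mul_assoc]
  have hSs : Sᵀ = S := by
    simp [hS, Matrix.transpose_mul, hA, Matrix.mul_assoc]
  have hAAE : A * A * E = E * (A * A) := by
    rw [Matrix.mul_assoc, hcomm, ← Matrix.mul_assoc, hcomm, Matrix.mul_assoc]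
  have hSQ : S * Q = V * E * (A * (A * (J * Vᵀ))) := by
    calc S * Q = V * (A * A) * (Vᵀ * V) * E * (J * Vᵀ) := by
          rw [hS, hQ]; simp only [Matrix.mul_assoc]
      _ = V * (A * A * E) * (J * Vᵀ) := by rw [hVV, Matrix.mul_one]; simp only [Matrix.mul_assoc]
      _ = _ := by rw [hAAE]; simp only [Matrix.mul_assoc]
  have hQS : Q * S = S * Q := by
    rw [hSQ]
    calc Q * S = V * E * J * (Vᵀ * V) * (A * A) * Vᵀ := by
          rw [hS, hQ]; simp only [Matrix.mul_assoc]
      _ = V * E * (J * (A * A)) * Vᵀ := by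
          rw [hVV, Matrix.mul_one]; simp only [Matrix.mul_assoc]
      _ = _ := by rw [← hAAJ]; simp only [Matrix.mul_assoc]
  rw [← hSQ, Matrix.transpose_mul, hSs, hm.2.1]
  refine trace_mul_eq_zero_of_anticommute hQQ ?_ hX'
  rw [hQS, ← Matrix.mul_assoc, hQS]

theorem curveLength_mul_exp_smul {n : ℕ} {V A J : Matrix (Fin n) (Fin n) ℝ}
    (hV : V ∈ Matrix.orthogonalGroup (Fin n) ℝ) (hJ : J ∈ Matrix.orthogonalGroup (Fin n) ℝ)
    (hA : Aᵀ = -A) :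
    curveLength (fun t => V * NormedSpace.exp (t • A) * (J * Vᵀ)) = ‖A‖ := by
  have key : ∀ t ∈ Set.Icc (0 : ℝ) 1,
      ‖derivWithin (fun t : ℝ => V * NormedSpace.exp (t • A) * (J * Vᵀ)) (Set.Icc 0 1) t‖ =
        ‖A‖ := by
    intro t ht
    have hd : derivWithin (fun t : ℝ => V * NormedSpace.exp (t • A) * (J * Vᵀ)) (Set.Icc 0 1) t =
        V * NormedSpace.exp (t • A) * (A * (J * Vᵀ)) :=
      (hasDerivAt_mul_exp_smul_mul V A (J * Vᵀ) t).hasDerivWithinAt.derivWithin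
        (uniqueDiffOn_Icc zero_lt_one t ht)
    rw [hd]
    have h1 := mul_mem hV (exp_smul_mem_orthogonalGroup hA t)
    have hV' : Vᵀ ∈ Matrix.orthogonalGroup (Fin n) ℝ := transpose_mem_orthogonalGroup hV
    rw [frobenius_norm_orthogonal_mul ((Matrix.mem_orthogonalGroup_iff' _ _).1 h1),
      frobenius_norm_mul_orthogonal ((Matrix.mem_orthogonalGroup_iff _ _).1 (mul_mem hJ hV'))]
  rw [curveLength, intervalIntegral.integral_congr (g := fun _ => ‖A‖)]
  · simp
  · intro t ht
    rw [Set.uIcc_of_le zero_le_one] at ht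
    exact key t ht

/-- A lower bound for the length of a curve in the Grassmannian in terms of the diagonals of its
endpoints in the orthonormal frame `O`. -/
theorem sum_mul_arccos_conj_sub_le {k n : ℕ} {O : Matrix (Fin n) (Fin n) ℝ}
    (hO : O ∈ Matrix.orthogonalGroup (Fin n) ℝ) {c : ℝ → Matrix (Fin n) (Fin n) ℝ}
    (hc : ContDiffOn ℝ 1 c (Set.Icc 0 1)) (hmem : ∀ t ∈ Set.Icc (0 : ℝ) 1, c t ∈ Grassmannian k n)
    {w : Fin n → ℝ} (hw : ∀ i, 0 ≤ w i) :
    ∑ i, w i * Real.arccos ((Oᵀ * c 1 * O) i i) - ∑ i, w i * Real.arccos ((Oᵀ * c 0 * O) i i) ≤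
      √(1 / 2 * ∑ i, w i ^ 2) * curveLength c := by
  have hO' : Oᵀ ∈ Matrix.orthogonalGroup (Fin n) ℝ := transpose_mem_orthogonalGroup hO
  have hmem' : ∀ t ∈ Set.Icc (0 : ℝ) 1, Oᵀ * c t * O ∈ Grassmannian k n := fun t ht => by
    simpa using conj_orthogonal_mem_grassmannian hO' (hmem t ht)
  have h := sum_mul_arccos_sub_le (c := fun t => Oᵀ * c t * O)
    ((contDiffOn_const.mul hc).mul contDiffOn_const)
    (fun t ht => mul_self_of_mem_grassmannian (hmem' t ht)) (fun t ht => (hmem' t ht).2.1) hw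
  have hlen : ∫ t in (0 : ℝ)..1, ‖derivWithin (fun t => Oᵀ * c t * O) (Set.Icc 0 1) t‖ =
      curveLength c := by
    refine intervalIntegral.integral_congr fun t ht => ?_
    rw [Set.uIcc_of_le zero_le_one] at ht
    have hd := (hc.differentiableOn one_ne_zero t ht).hasDerivWithinAt
    have hd' := (hd.const_mul Oᵀ).mul_const O
    have e : derivWithin (fun t => Oᵀ * c t * O) (Set.Icc 0 1) t =
        Oᵀ * derivWithin c (Set.Icc 0 1) t * O :=
      hd'.derivWithin (uniqueDiffOn_Icc zero_lt_one t ht)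
    change ‖derivWithin (fun t => Oᵀ * c t * O) (Set.Icc 0 1) t‖ = _
    rw [e,
      frobenius_norm_mul_orthogonal ((Matrix.mem_orthogonalGroup_iff _ _).1 hO),
      frobenius_norm_orthogonal_mul ((Matrix.mem_orthogonalGroup_iff' _ _).1 hO')]
  rwa [hlen] at h

/-! ### The CS rotation as a matrix exponential. -/

section Rotation

variable {κ ρ : Type*} [Fintype κ] [DecidableEq κ] [Fintype ρ] [DecidableEq ρ]

/-- The rotation by the angles `θ` in the planes spanned by corresponding vectors of the first two
of three blocks of coordinates. -/
noncomputable def blockRotation (ρ : Type*) [DecidableEq ρ] (θ : κ → ℝ) :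
    Matrix (κ ⊕ (κ ⊕ ρ)) (κ ⊕ (κ ⊕ ρ)) ℝ :=
  Matrix.fromBlocks (Matrix.diagonal fun i => Real.cos (θ i))
    (Matrix.fromCols (Matrix.diagonal fun i => Real.sin (θ i)) 0)
    (Matrix.fromRows (-Matrix.diagonal fun i => Real.sin (θ i)) 0)
    (Matrix.fromBlocks (Matrix.diagonal fun i => Real.cos (θ i)) 0 0 1)

/-- The infinitesimal generator of `blockRotation`. -/
def blockRotationGenerator (ρ : Type*) (θ : κ → ℝ) :
    Matrix (κ ⊕ (κ ⊕ ρ)) (κ ⊕ (κ ⊕ ρ)) ℝ :=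
  Matrix.fromBlocks 0 (Matrix.fromCols (Matrix.diagonal θ) 0)
    (-(Matrix.fromCols (Matrix.diagonal θ) 0)ᵀ) 0

theorem blockRotationGenerator_mul_blockRotation (θ φ : κ → ℝ) :
    blockRotationGenerator ρ θ * blockRotation ρ φ =
      Matrix.fromBlocks (-Matrix.diagonal fun i => θ i * Real.sin (φ i))
        (Matrix.fromCols (Matrix.diagonal fun i => θ i * Real.cos (φ i)) 0)
        (Matrix.fromRows (-Matrix.diagonal fun i => θ i * Real.cos (φ i)) 0)
        (Matrix.fromBlocks (-Matrix.diagonal fun i => θ i * Real.sin (φ i)) 0 0 0) := by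
  rw [blockRotationGenerator, blockRotation, Matrix.fromBlocks_multiply,
    Matrix.transpose_fromCols]
  ext (i | i | i) (j | j | j) <;>
    simp [Matrix.mul_apply, Fintype.sum_sum_type, Matrix.diagonal_apply]
  all_goals split_ifs with hij <;> simp [hij]

theorem hasDerivAt_blockRotation (θ : κ → ℝ) (t : ℝ) :
    HasDerivAt (fun s : ℝ => blockRotation ρ fun i => s * θ i)
      (blockRotationGenerator ρ θ * blockRotation ρ fun i => t * θ i) t := by
  have hlin : ∀ i, HasDerivAt (fun s : ℝ => s * θ i) (θ i) t := fun i => by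
    simpa using (hasDerivAt_id t).mul_const (θ i)
  have hcos : ∀ i, HasDerivAt (fun s : ℝ => Real.cos (s * θ i))
      (-(θ i * Real.sin (t * θ i))) t := fun i => by
    simpa [mul_comm] using (hlin i).cos
  have hsin : ∀ i, HasDerivAt (fun s : ℝ => Real.sin (s * θ i))
      (θ i * Real.cos (t * θ i)) t := fun i => by
    simpa [mul_comm] using (hlin i).sin
  rw [blockRotationGenerator_mul_blockRotation]
  refine hasDerivAt_pi.2 fun a => hasDerivAt_pi.2 fun b => ?_
  rcases a with i | i | i <;> rcases b with j | j | j <;>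
    simp only [blockRotation, Matrix.fromBlocks_apply₁₁, Matrix.fromBlocks_apply₁₂,
      Matrix.fromBlocks_apply₂₁, Matrix.fromBlocks_apply₂₂, Matrix.fromCols_apply_inl,
      Matrix.fromCols_apply_inr, Matrix.fromRows_apply_inl, Matrix.fromRows_apply_inr,
      Matrix.neg_apply, Matrix.zero_apply]
  all_goals first
    | exact hasDerivAt_const _ _
    | (rcases eq_or_ne i j with rfl | hij
       · simp only [Matrix.diagonal_apply_eq]
         first
         | exact hcos _
         | exact hsin _
         | exact (hsin _).neg
       · simp only [Matrix.diagonal_apply_ne _ hij, neg_zero]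
         exact hasDerivAt_const _ _)

/-- The rotation by `tθ` solves `Y' = TY` with `Y(0) = 1`, so `exp(-tT) Y(t)` has zero derivative
and stays equal to `1`. -/
theorem exp_blockRotationGenerator (θ : κ → ℝ) :
    NormedSpace.exp (blockRotationGenerator ρ θ) = blockRotation ρ θ := by
  set T := blockRotationGenerator ρ θ with hT
  set F : ℝ → Matrix (κ ⊕ (κ ⊕ ρ)) (κ ⊕ (κ ⊕ ρ)) ℝ := fun t =>
    NormedSpace.exp (t • -T) * blockRotation ρ fun i => t * θ i with hF
  have hd : ∀ t, HasDerivAt F 0 t := fun t => by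
    have h1 := (hasDerivAt_exp_smul_const (𝕂 := ℝ) (-T) t).mul
      (hasDerivAt_blockRotation (ρ := ρ) θ t)
    have e : NormedSpace.exp (t • -T) * -T * (blockRotation ρ fun i => t * θ i) +
        NormedSpace.exp (t • -T) * (T * blockRotation ρ fun i => t * θ i) = 0 := by
      rw [Matrix.mul_neg, Matrix.neg_mul, Matrix.mul_assoc, neg_add_cancel]
    rw [← e]
    exact h1
  have hconst : F 1 = F 0 :=
    is_const_of_deriv_eq_zero (fun t => (hd t).differentiableAt) (fun t => (hd t).deriv) 1 0
  have h0 : F 0 = 1 := by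
    have : (blockRotation ρ fun i : κ => 0 * θ i) = 1 := by
      simp [blockRotation, Matrix.diagonal_one]
    simp only [hF]
    rw [this]; simp
  have h1 : NormedSpace.exp ((1 : ℝ) • -T) * blockRotation ρ θ = 1 := by
    rw [← h0, ← hconst]; simp [hF]
  calc NormedSpace.exp T = NormedSpace.exp ((1 : ℝ) • T) *
        (NormedSpace.exp ((1 : ℝ) • -T) * blockRotation ρ θ) := by rw [h1, Matrix.mul_one, one_smul]
    _ = blockRotation ρ θ := by
        rw [← Matrix.mul_assoc, exp_smul_mul_exp_smul_neg, Matrix.one_mul]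

theorem exp_reindex {m p : Type*} [Fintype m] [DecidableEq m] [Fintype p] [DecidableEq p]
    (e : m ≃ p) (M : Matrix m m ℝ) :
    NormedSpace.exp (Matrix.reindex e e M) = Matrix.reindex e e (NormedSpace.exp M) := by
  have hc : Continuous (Matrix.reindexAlgEquiv ℝ ℝ e) :=
    continuous_id.matrix_reindex e e
  exact (NormedSpace.map_exp (Matrix.reindexAlgEquiv ℝ ℝ e) hc M).symm

end Rotation

/-! ### Block calculus and the signature matrix. -/

section Blocks

variable {k n : ℕ} (hk : k ≤ n)

theorem blockMatrix_mul (A A' : Matrix (Fin k) (Fin k) ℝ) (B B' : Matrix (Fin k) (Fin (n - k)) ℝ)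
    (C C' : Matrix (Fin (n - k)) (Fin k) ℝ) (D D' : Matrix (Fin (n - k)) (Fin (n - k)) ℝ) :
    blockMatrix hk A B C D * blockMatrix hk A' B' C' D' =
      blockMatrix hk (A * A' + B * C') (A * B' + B * D') (C * A' + D * C') (C * B' + D * D') := by
  simp only [blockMatrix, Matrix.reindex_apply, Matrix.submatrix_mul_equiv,
    Matrix.fromBlocks_multiply]

theorem blockMatrix_transpose (A : Matrix (Fin k) (Fin k) ℝ) (B : Matrix (Fin k) (Fin (n - k)) ℝ)
    (C : Matrix (Fin (n - k)) (Fin k) ℝ) (D : Matrix (Fin (n - k)) (Fin (n - k)) ℝ) :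
    (blockMatrix hk A B C D)ᵀ = blockMatrix hk Aᵀ Cᵀ Bᵀ Dᵀ := by
  simp only [blockMatrix, Matrix.reindex_apply, Matrix.transpose_submatrix,
    Matrix.fromBlocks_transpose]

theorem blockMatrix_smul (r : ℝ) (A : Matrix (Fin k) (Fin k) ℝ)
    (B : Matrix (Fin k) (Fin (n - k)) ℝ) (C : Matrix (Fin (n - k)) (Fin k) ℝ)
    (D : Matrix (Fin (n - k)) (Fin (n - k)) ℝ) :
    r • blockMatrix hk A B C D = blockMatrix hk (r • A) (r • B) (r • C) (r • D) := by
  simp only [blockMatrix, Matrix.reindex_apply, ← Matrix.fromBlocks_smul]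
  rfl

theorem neg_blockMatrix (A : Matrix (Fin k) (Fin k) ℝ)
    (B : Matrix (Fin k) (Fin (n - k)) ℝ) (C : Matrix (Fin (n - k)) (Fin k) ℝ)
    (D : Matrix (Fin (n - k)) (Fin (n - k)) ℝ) :
    -blockMatrix hk A B C D = blockMatrix hk (-A) (-B) (-C) (-D) := by
  simp only [blockMatrix, Matrix.reindex_apply, ← Matrix.fromBlocks_neg]
  rfl

theorem blockMatrix_one : blockMatrix hk 1 0 0 1 = 1 := by
  simp [blockMatrix]

theorem blockMatrix_diag_mem_orthogonalGroup {U : Matrix (Fin k) (Fin k) ℝ}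
    {V : Matrix (Fin (n - k)) (Fin (n - k)) ℝ} (hU : U ∈ Matrix.orthogonalGroup (Fin k) ℝ)
    (hV : V ∈ Matrix.orthogonalGroup (Fin (n - k)) ℝ) :
    blockMatrix hk U 0 0 V ∈ Matrix.orthogonalGroup (Fin n) ℝ := by
  have hU' := (Matrix.mem_orthogonalGroup_iff _ _).1 hU
  have hV' := (Matrix.mem_orthogonalGroup_iff _ _).1 hV
  rw [Matrix.mem_orthogonalGroup_iff, blockMatrix_transpose, blockMatrix_mul]
  simp [hU', hV', blockMatrix_one]

/-- Block diagonal orthogonal matrices fix the signature matrix under conjugation, which removes `U,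
V, W, Z` from the endpoint computations. -/
theorem blockMatrix_diag_conj_signatureMatrix {U : Matrix (Fin k) (Fin k) ℝ}
    {V : Matrix (Fin (n - k)) (Fin (n - k)) ℝ} (hU : U ∈ Matrix.orthogonalGroup (Fin k) ℝ)
    (hV : V ∈ Matrix.orthogonalGroup (Fin (n - k)) ℝ) :
    (blockMatrix hk U 0 0 V)ᵀ * signatureMatrix hk * blockMatrix hk U 0 0 V =
      signatureMatrix hk := by
  have hU' := (Matrix.mem_orthogonalGroup_iff' _ _).1 hU
  have hV' := (Matrix.mem_orthogonalGroup_iff' _ _).1 hV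
  rw [signatureMatrix, blockMatrix_transpose, blockMatrix_mul, blockMatrix_mul]
  simp [hU', hV']

theorem blockMatrix_off_diag_transpose (B : Matrix (Fin k) (Fin (n - k)) ℝ) :
    (blockMatrix hk 0 (-B) Bᵀ 0)ᵀ = -blockMatrix hk 0 (-B) Bᵀ 0 := by
  rw [blockMatrix_transpose, neg_blockMatrix]
  simp

theorem signatureMatrix_mul_off_diag (B : Matrix (Fin k) (Fin (n - k)) ℝ) :
    signatureMatrix hk * blockMatrix hk 0 (-B) Bᵀ 0 =
      -(blockMatrix hk 0 (-B) Bᵀ 0 * signatureMatrix hk) := by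
  rw [signatureMatrix, blockMatrix_mul, blockMatrix_mul, neg_blockMatrix]
  simp

theorem off_diag_mul_signatureMatrix (B : Matrix (Fin k) (Fin (n - k)) ℝ) :
    blockMatrix hk 0 (-B) Bᵀ 0 * signatureMatrix hk = blockMatrix hk 0 B Bᵀ 0 := by
  rw [signatureMatrix, blockMatrix_mul]
  simp

theorem signatureMatrix_mul_self : signatureMatrix hk * signatureMatrix hk = 1 := by
  rw [signatureMatrix, blockMatrix_mul, ← blockMatrix_one hk]
  simp

theorem frobenius_norm_off_diag_sq (B : Matrix (Fin k) (Fin (n - k)) ℝ) :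
    ‖blockMatrix hk 0 (-B) Bᵀ 0‖ ^ 2 = 2 * ‖B‖ ^ 2 := by
  rw [frobenius_norm_sq, frobenius_norm_sq, ← (splitEquiv hk).sum_comp]
  simp_rw [← (splitEquiv hk).sum_comp (fun j => blockMatrix hk 0 (-B) Bᵀ 0 _ j ^ 2)]
  simp only [blockMatrix, Matrix.reindex_apply, Matrix.submatrix_apply, Equiv.symm_apply_apply,
    Fintype.sum_sum_type, Matrix.fromBlocks_apply₁₁, Matrix.fromBlocks_apply₁₂,
    Matrix.fromBlocks_apply₂₁, Matrix.fromBlocks_apply₂₂, Matrix.transpose_apply,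
    Matrix.neg_apply, Matrix.zero_apply]
  have hswap : ∑ j, ∑ i, B i j ^ 2 = ∑ i, ∑ j, B i j ^ 2 := Finset.sum_comm
  simp [hswap, two_mul]

theorem expCurve_eq (V₀ : Matrix (Fin n) (Fin n) ℝ) (B : Matrix (Fin k) (Fin (n - k)) ℝ) (t : ℝ) :
    expCurve hk V₀ B t = V₀ * (NormedSpace.exp ((t / 2) • blockMatrix hk 0 (-B) Bᵀ 0) *
      signatureMatrix hk * NormedSpace.exp ((t / 2) • -blockMatrix hk 0 (-B) Bᵀ 0)) * V₀ᵀ := by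
  have e : blockMatrix hk 0 B (-Bᵀ) 0 = -blockMatrix hk 0 (-B) Bᵀ 0 := by
    rw [neg_blockMatrix]; simp
  rw [expCurve, e]
  simp only [Matrix.mul_assoc]

theorem expCurve_eq_mul_exp_smul (V₀ : Matrix (Fin n) (Fin n) ℝ)
    (B : Matrix (Fin k) (Fin (n - k)) ℝ) (t : ℝ) :
    expCurve hk V₀ B t = V₀ * NormedSpace.exp (t • blockMatrix hk 0 (-B) Bᵀ 0) *
      (signatureMatrix hk * V₀ᵀ) := by
  rw [expCurve_eq, exp_half_conj_involution (signatureMatrix_mul_self hk)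
    (signatureMatrix_mul_off_diag hk B)]
  simp only [Matrix.mul_assoc]

end Blocks

/-! ### The CS matrix in three-block coordinates. -/

section CS

variable {k n : ℕ} (h : 2 * k ≤ n)

/-- The splitting of `n` coordinates into `k`, `k` and `n - 2k`. -/
def splitEquivThree : Fin k ⊕ (Fin k ⊕ Fin (n - 2 * k)) ≃ Fin n :=
  ((Equiv.refl (Fin k)).sumCongr (splitEquivTail h)).trans (splitEquiv (le_of_two_mul_le h))

theorem csMatrix_eq_reindex (θ : Fin k → ℝ) :
    csMatrix h θ = Matrix.reindex (splitEquivThree h) (splitEquivThree h)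
      (blockRotation (Fin (n - 2 * k)) θ) := by
  apply (Matrix.reindex (splitEquivThree h) (splitEquivThree h)).symm.injective
  rw [Equiv.symm_apply_apply]
  ext (i | i | i) (j | j | j) <;>
    simp [csMatrix, splitEquivThree, blockMatrix, blockRotation, padRight, padBelow]

theorem blockMatrix_generator_eq_reindex (θ : Fin k → ℝ) :
    blockMatrix (le_of_two_mul_le h) 0 (padRight h (Matrix.diagonal θ))
        (-(padRight h (Matrix.diagonal θ))ᵀ) 0 =
      Matrix.reindex (splitEquivThree h) (splitEquivThree h)
        (blockRotationGenerator (Fin (n - 2 * k)) θ) := by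
  apply (Matrix.reindex (splitEquivThree h) (splitEquivThree h)).symm.injective
  rw [Equiv.symm_apply_apply]
  ext (i | i | i) (j | j | j) <;>
    simp [splitEquivThree, blockMatrix, blockRotationGenerator, padRight]

theorem exp_generator_eq_csMatrix (θ : Fin k → ℝ) :
    NormedSpace.exp (blockMatrix (le_of_two_mul_le h) 0 (padRight h (Matrix.diagonal θ))
      (-(padRight h (Matrix.diagonal θ))ᵀ) 0) = csMatrix h θ := by
  rw [blockMatrix_generator_eq_reindex, csMatrix_eq_reindex, exp_reindex,
    exp_blockRotationGenerator]

/-- The factor `-2` in `B` cancels both the `1/2` and the sign of the upper right block, leaving the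
rotation generator with angles exactly `θ`, conjugated by `diag(U, V)`. -/
theorem exp_half_off_diag_eq {U : Matrix (Fin k) (Fin k) ℝ}
    {V : Matrix (Fin (n - k)) (Fin (n - k)) ℝ} (hU : U ∈ Matrix.orthogonalGroup (Fin k) ℝ)
    (hV : V ∈ Matrix.orthogonalGroup (Fin (n - k)) ℝ) (θ : Fin k → ℝ)
    {B : Matrix (Fin k) (Fin (n - k)) ℝ}
    (hB : B = (-2 : ℝ) • (U * padRight h (Matrix.diagonal θ) * Vᵀ)) :
    NormedSpace.exp ((1 / 2 : ℝ) • blockMatrix (le_of_two_mul_le h) 0 (-B) Bᵀ 0) =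
      blockMatrix (le_of_two_mul_le h) U 0 0 V * csMatrix h θ *
        (blockMatrix (le_of_two_mul_le h) U 0 0 V)ᵀ := by
  set P := padRight h (Matrix.diagonal θ) with hP
  have hD := blockMatrix_diag_mem_orthogonalGroup (le_of_two_mul_le h) hU hV
  set D := blockMatrix (le_of_two_mul_le h) U 0 0 V with hDdef
  have hD1 := (Matrix.mem_orthogonalGroup_iff _ _).1 hD
  have hD2 := (Matrix.mem_orthogonalGroup_iff' _ _).1 hD
  have e : (1 / 2 : ℝ) • blockMatrix (le_of_two_mul_le h) 0 (-B) Bᵀ 0 =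
      D * blockMatrix (le_of_two_mul_le h) 0 P (-Pᵀ) 0 * Dᵀ := by
    rw [hDdef, blockMatrix_transpose, blockMatrix_mul, blockMatrix_mul, blockMatrix_smul, hB]
    simp [smul_smul, Matrix.transpose_mul, Matrix.mul_assoc]
  let u : (Matrix (Fin n) (Fin n) ℝ)ˣ := ⟨D, Dᵀ, hD1, hD2⟩
  rw [e, ← exp_generator_eq_csMatrix h θ]
  exact Matrix.exp_units_conj u _

theorem frobenius_norm_padRight_diagonal_sq (θ : Fin k → ℝ) :
    ‖padRight h (Matrix.diagonal θ)‖ ^ 2 = ∑ i, θ i ^ 2 := by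
  rw [frobenius_norm_sq]
  refine Finset.sum_congr rfl fun i _ => ?_
  rw [← (splitEquivTail h).sum_comp]
  simp [padRight, Fintype.sum_sum_type, Matrix.diagonal_apply, ite_pow]

theorem csMatrix_conj_signatureMatrix_diag (θ : Fin k → ℝ) (i : Fin k) :
    (csMatrix h θ * signatureMatrix (le_of_two_mul_le h) * (csMatrix h θ)ᵀ)
      (splitEquiv (le_of_two_mul_le h) (Sum.inl i))
      (splitEquiv (le_of_two_mul_le h) (Sum.inl i)) = Real.cos (2 * θ i) := by
  have e : (padRight h (Matrix.diagonal fun i => Real.sin (θ i)) *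
      (padRight h (Matrix.diagonal fun i => Real.sin (θ i)))ᵀ) i i = Real.sin (θ i) ^ 2 := by
    rw [Matrix.mul_apply, ← (splitEquivTail h).sum_comp]
    simp [padRight, Fintype.sum_sum_type, Matrix.diagonal_apply, sq]
  rw [csMatrix, signatureMatrix, blockMatrix_transpose, blockMatrix_mul, blockMatrix_mul]
  rw [Real.cos_two_mul']
  simp [blockMatrix, e, sq]
  ring

end CS

/-! ### Minimality and the main theorem. -/

/-- A curve whose endpoints are `J` and `R J Rᵀ` in the frame `O`, where `R` is the rotation by
angles `θᵢ ∈ [0, π/2]`, is minimizing if its length is `2 √2 ‖θ‖`. -/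
theorem isLengthMinimizing_of_csMatrix {k n : ℕ} (h : 2 * k ≤ n)
    {O : Matrix (Fin n) (Fin n) ℝ} (hO : O ∈ Matrix.orthogonalGroup (Fin n) ℝ) {θ : Fin k → ℝ}
    (hθ : ∀ i, θ i ∈ Set.Icc 0 (Real.pi / 2)) {γ : ℝ → Matrix (Fin n) (Fin n) ℝ}
    (h0 : Oᵀ * γ 0 * O = signatureMatrix (le_of_two_mul_le h))
    (h1 : Oᵀ * γ 1 * O = csMatrix h θ * signatureMatrix (le_of_two_mul_le h) * (csMatrix h θ)ᵀ)
    (hlen : curveLength γ ^ 2 = 8 * ∑ i, θ i ^ 2) : IsLengthMinimizing k n γ := by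
  intro c hc hmem hc0 hc1
  set e := splitEquiv (le_of_two_mul_le h) with he
  -- Weights proportional to the angle increments `2θᵢ` give the optimal lower bound; the remaining
  -- coordinates get weight `0`.
  set w : Fin n → ℝ := fun j => Sum.elim θ (fun _ => 0) (e.symm j) with hw
  have hw0 : ∀ j, 0 ≤ w j := fun j => by
    simp only [hw]
    rcases e.symm j with i | i
    · exact (hθ i).1
    · exact le_rfl
  have hb := sum_mul_arccos_conj_sub_le hO hc hmem hw0
  rw [hc0, hc1, h0, h1, ← e.sum_comp, ← e.sum_comp, ← e.sum_comp] at hb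
  simp only [Fintype.sum_sum_type, hw, Equiv.symm_apply_apply, Sum.elim_inl, Sum.elim_inr,
    zero_mul, Finset.sum_const_zero, add_zero, ne_eq, OfNat.ofNat_ne_zero, not_false_eq_true,
    zero_pow] at hb
  have hb0 : ∑ i, θ i * Real.arccos
      (signatureMatrix (le_of_two_mul_le h) (e (Sum.inl i)) (e (Sum.inl i))) = 0 :=
    Finset.sum_eq_zero fun i _ => by simp [signatureMatrix, blockMatrix, he]
  have hb1 : ∑ i, θ i * Real.arccos
      ((csMatrix h θ * signatureMatrix (le_of_two_mul_le h) * (csMatrix h θ)ᵀ)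
        (e (Sum.inl i)) (e (Sum.inl i))) = 2 * ∑ i, θ i ^ 2 := by
    rw [Finset.mul_sum]
    refine Finset.sum_congr rfl fun i _ => ?_
    rw [he, csMatrix_conj_signatureMatrix_diag, Real.arccos_cos]
    · ring
    · linarith [(hθ i).1]
    · linarith [(hθ i).2]
  rw [hb0, hb1, sub_zero] at hb
  set S := ∑ i, θ i ^ 2 with hS
  have hS0 : 0 ≤ S := Finset.sum_nonneg fun i _ => sq_nonneg _
  have hγ : 0 ≤ curveLength γ :=
    intervalIntegral.integral_nonneg zero_le_one fun t _ => norm_nonneg _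
  have hL : 0 ≤ curveLength c :=
    intervalIntegral.integral_nonneg zero_le_one fun t _ => norm_nonneg _
  refine (sq_le_sq₀ hγ hL).1 ?_
  rw [hlen]
  have hsq : (2 * S) ^ 2 ≤ (√(1 / 2 * S) * curveLength c) ^ 2 :=
    pow_le_pow_left₀ (by positivity) hb 2
  rw [mul_pow (√_), Real.sq_sqrt (by positivity)] at hsq
  -- `hsq` reads `4S² ≤ (S/2) L²` with `L` the length of `c`. Cancelling `S` requires `S ≠ 0`; for
  -- `S = 0` the claim is `0 ≤ L²`.
  rcases hS0.eq_or_lt with hS1 | hS1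
  · rw [← hS1]; nlinarith
  · refine le_of_mul_le_mul_left ?_ hS1
    linarith

theorem proposition4p4 (k n : ℕ) (h : 2 * k ≤ n)
    (Q₀ Q₁ V₀ V₁ : Matrix (Fin n) (Fin n) ℝ)
    (hQ₀ : Q₀ ∈ Grassmannian k n) (hQ₁ : Q₁ ∈ Grassmannian k n)
    (hV₀ : V₀ ∈ Matrix.orthogonalGroup (Fin n) ℝ)
    (hV₁ : V₁ ∈ Matrix.orthogonalGroup (Fin n) ℝ)
    (hQV₀ : Q₀ = V₀ * signatureMatrix (le_of_two_mul_le h) * V₀ᵀ)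
    (hQV₁ : Q₁ = V₁ * signatureMatrix (le_of_two_mul_le h) * V₁ᵀ)
    (U W : Matrix (Fin k) (Fin k) ℝ) (V Z : Matrix (Fin (n - k)) (Fin (n - k)) ℝ)
    (hU : U ∈ Matrix.orthogonalGroup (Fin k) ℝ)
    (hW : W ∈ Matrix.orthogonalGroup (Fin k) ℝ)
    (hV : V ∈ Matrix.orthogonalGroup (Fin (n - k)) ℝ)
    (hZ : Z ∈ Matrix.orthogonalGroup (Fin (n - k)) ℝ)
    (θ : Fin k → ℝ)
    (hCS : V₀ᵀ * V₁ = blockMatrix (le_of_two_mul_le h) U 0 0 V * csMatrix h θ *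
      (blockMatrix (le_of_two_mul_le h) W 0 0 Z)ᵀ)
    (B : Matrix (Fin k) (Fin (n - k)) ℝ)
    (hB : B = (-2 : ℝ) • (U * padRight h (Matrix.diagonal θ) * Vᵀ))
    (γ : ℝ → Matrix (Fin n) (Fin n) ℝ)
    (hγ : ∀ t, γ t = expCurve (le_of_two_mul_le h) V₀ B t) :
    IsGrassmannGeodesic k n γ ∧ γ 0 = Q₀ ∧ γ 1 = Q₁ ∧
      HasDerivAt γ (V₀ * blockMatrix (le_of_two_mul_le h) 0 B Bᵀ 0 * V₀ᵀ) 0 ∧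
      ((∀ i, θ i ∈ Set.Icc 0 (Real.pi / 2)) → IsLengthMinimizing k n γ) := by
  set J := signatureMatrix (le_of_two_mul_le h) with hJdef
  set A := blockMatrix (le_of_two_mul_le h) 0 (-B) Bᵀ 0 with hAdef
  set D := blockMatrix (le_of_two_mul_le h) U 0 0 V with hDdef
  set F := blockMatrix (le_of_two_mul_le h) W 0 0 Z with hFdef
  set R := csMatrix h θ with hRdef
  have hγ' : γ = fun t : ℝ => V₀ * NormedSpace.exp (t • A) * (J * V₀ᵀ) :=
    funext fun t => by rw [hγ, expCurve_eq_mul_exp_smul]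
  have hA : Aᵀ = -A := blockMatrix_off_diag_transpose _ B
  have hJA : J * A = -(A * J) := signatureMatrix_mul_off_diag _ B
  have hV1 : V₀ * V₀ᵀ = 1 := (Matrix.mem_orthogonalGroup_iff _ _).1 hV₀
  have hV2 : V₀ᵀ * V₀ = 1 := (Matrix.mem_orthogonalGroup_iff' _ _).1 hV₀
  have hD := blockMatrix_diag_mem_orthogonalGroup (le_of_two_mul_le h) hU hV
  have hF := blockMatrix_diag_mem_orthogonalGroup (le_of_two_mul_le h) hW hZ
  have hDJ : Dᵀ * J * D = J := blockMatrix_diag_conj_signatureMatrix _ hU hV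
  have hFJ : Fᵀ * J * F = J := blockMatrix_diag_conj_signatureMatrix _ hW hZ
  have hD2 : Dᵀ * D = 1 := (Matrix.mem_orthogonalGroup_iff' _ _).1 hD
  -- Conjugating `Q₀` back by `V₀` avoids computing the trace of `J`.
  have hJ : J ∈ Grassmannian k n := by
    have := conj_orthogonal_mem_grassmannian (transpose_mem_orthogonalGroup hV₀) hQ₀
    rw [hQV₀, Matrix.transpose_transpose] at this
    have e : V₀ᵀ * (V₀ * J * V₀ᵀ) * V₀ = (V₀ᵀ * V₀) * J * (V₀ᵀ * V₀) := by
      simp only [Matrix.mul_assoc]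
    rwa [e, hV2, Matrix.one_mul, Matrix.mul_one] at this
  have hγ0 : γ 0 = Q₀ := by
    rw [hγ', hQV₀]; simp [Matrix.mul_assoc]
  have hQ₁' : Q₁ = V₀ * D * (R * J * Rᵀ) * (V₀ * D)ᵀ := by
    have hV₁' : V₁ = V₀ * (D * R * Fᵀ) := by
      rw [← hCS, ← Matrix.mul_assoc, hV1, Matrix.one_mul]
    calc Q₁ = V₀ * D * R * (Fᵀ * J * F) * Rᵀ * Dᵀ * V₀ᵀ := by
          rw [hQV₁, hV₁']
          simp only [Matrix.transpose_mul, Matrix.transpose_transpose, Matrix.mul_assoc]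
      _ = _ := by
          rw [hFJ]; simp only [Matrix.transpose_mul, Matrix.mul_assoc]
  have hexp : NormedSpace.exp ((1 / 2 : ℝ) • A) = D * R * Dᵀ :=
    exp_half_off_diag_eq h hU hV θ hB
  have hγ1 : γ 1 = Q₁ := by
    rw [hγ, expCurve_eq, ← hAdef, ← hJdef, ← exp_smul_transpose_of_skew hA, hexp, hQ₁']
    calc V₀ * (D * R * Dᵀ * J * (D * R * Dᵀ)ᵀ) * V₀ᵀ =
          V₀ * (D * R * (Dᵀ * J * D) * Rᵀ * Dᵀ) * V₀ᵀ := by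
          simp only [Matrix.transpose_mul, Matrix.transpose_transpose, Matrix.mul_assoc]
      _ = _ := by rw [hDJ]; simp only [Matrix.transpose_mul, Matrix.mul_assoc]
  refine ⟨hγ' ▸ isGrassmannGeodesic_mul_exp_smul hV₀ hJ hA hJA, hγ0, hγ1, ?_, fun hθ => ?_⟩
  · have hd := hasDerivAt_mul_exp_smul_mul V₀ A (J * V₀ᵀ) 0
    have e : V₀ * NormedSpace.exp ((0 : ℝ) • A) * (A * (J * V₀ᵀ)) =
        V₀ * blockMatrix (le_of_two_mul_le h) 0 B Bᵀ 0 * V₀ᵀ := by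
      rw [← off_diag_mul_signatureMatrix]
      simp [Matrix.mul_assoc, hAdef, hJdef]
    rw [← e, hγ']
    exact hd
  · have hOO : (V₀ * D)ᵀ * (V₀ * D) = 1 :=
      (Matrix.mem_orthogonalGroup_iff' _ _).1 (mul_mem hV₀ hD)
    refine isLengthMinimizing_of_csMatrix h (mul_mem hV₀ hD) hθ ?_ ?_ ?_
    · rw [hγ0, hQV₀]
      calc (V₀ * D)ᵀ * (V₀ * J * V₀ᵀ) * (V₀ * D) =
            Dᵀ * (V₀ᵀ * V₀) * J * (V₀ᵀ * V₀) * D := by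
            simp only [Matrix.transpose_mul, Matrix.mul_assoc]
        _ = J := by rw [hV2, Matrix.mul_one, Matrix.mul_one, hDJ]
    · rw [hγ1, hQ₁']
      calc (V₀ * D)ᵀ * (V₀ * D * (R * J * Rᵀ) * (V₀ * D)ᵀ) * (V₀ * D) =
            ((V₀ * D)ᵀ * (V₀ * D)) * (R * J * Rᵀ) * ((V₀ * D)ᵀ * (V₀ * D)) := by
            simp only [Matrix.mul_assoc]
        _ = _ := by rw [hOO, Matrix.one_mul, Matrix.mul_one]
    -- The squared length is `‖A‖² = 2‖B‖² = 2 · 4 ∑ θᵢ²`.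
    · rw [hγ', curveLength_mul_exp_smul hV₀ hJ.1 hA, hAdef, frobenius_norm_off_diag_sq, hB,
        norm_smul, mul_pow,
        frobenius_norm_mul_orthogonal
          ((Matrix.mem_orthogonalGroup_iff _ _).1 (transpose_mem_orthogonalGroup hV)),
        frobenius_norm_orthogonal_mul ((Matrix.mem_orthogonalGroup_iff' _ _).1 hU),
        frobenius_norm_padRight_diagonal_sq]
      norm_num
      ring
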